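/- **Games.** A simple stochastic game (SSG) $G$ consists of a finite directed graph with vertex set $V$ partitioned into $V_{\max}, V_{\min}, V_R, V_S$ (only $V_S$ is required to be non-empty). Every vertex of $V_{\max}\cup V_{\min}\cup V_R$ has at least one outgoing arc, and the only outgoing arc of a sink $s\in V_S$ is a loop. For each $x\in V_R$ there is a probability distribution $p_x$ with $p_x(y)>0$ if and only if $(x,y)$ is an arc, and each $s\in V_S$ has a value $\mathrm{Val}(s)\in[0,1]$. Probabilities and values are real numbers (in particular, they may be rational). The game is not assumed to be stopping. **Strategies and values.** A general strategy of MAX (MIN) assigns to each history $(x_0,\dots,x_k)$ with $x_k\in V_{\max}$ ($x_k\in V_{\min}$) an outneighbour of $x_k$; it is positional if this depends on $x_k$ only. A starting vertex $x$ and general strategies $\sigma,\tau$ of MAX and MIN define a random infinite play, which moves according to $\sigma$, $\tau$, $p_x$ and stays in a sink once it is reached. Its value is $\mathrm{Val}(s)$ if it reaches the sink $s$, and $0$ if it reaches no sink; $v^G_{\sigma,\tau}(x)$ is the expected value. A positional MIN strategy $\tau$ is a best response to $\sigma$ if $v^G_{\sigma,\tau}\le v^G_{\sigma,\tau'}$ pointwise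 for all general MIN strategies $\tau'$; best responses of MAX are defined symmetrically. A pair $(\sigma,\tau)$ of positional strategies is optimal if $\sigma$ and $\tau$ are best responses to each other. For a positional MAX strategy $\sigma$ let $v^G_\sigma(x)=\inf_{\tau}v^G_{\sigma,\tau}(x)$ over general MIN strategies $\tau$, that is, $v^G_\sigma=v^G_{\sigma,\tau}$ for every best response $\tau$ to $\sigma$. For positional MAX strategies write $\sigma'\succ_G\sigma$ if $v^G_{\sigma'}\ge v^G_\sigma$ pointwise with strict inequality at some vertex, and $\sigma'(x)=\sigma(x)$ for every $x\in V_{\max}$ with $v^G_{\sigma'}(x)=v^G_\sigma(x)$. **Transformed game.** For a set $A$ of arcs of $G$ and a positional MAX strategy $\sigma$, the SSG $G[A,\sigma]$ is obtained from $G$ by adding a sink $s_e$ of value $v^G_\sigma(y)$ for each $e=(x,y)\in A$ and replacing each $e=(x,y)\in A$ with $x\notin V_S$ by the arc $(x,s_e)$ (loops of sinks are left in place). Strategies of $G$ and of $G[A,\sigma]$ are identified. **Algorithm.** The Generic Strategy Improvement Algorithm (GSIA), on input $G$: 1. Select a positional MAX strategy $\sigma$. 2. Take a positional best response $\tau$ of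 MIN to $\sigma$. If $(\sigma,\tau)$ is optimal in $G$, return $(\sigma,\tau)$. 3. Otherwise choose a set $A$ of arcs of $G$, find a positional MAX strategy $\sigma'$ with $\sigma'\succ_{G[A,\sigma]}\sigma$, replace $\sigma$ by $\sigma'$ and go to 2. All choices (of the initial $\sigma$, of $\tau$, $A$ and $\sigma'$) are arbitrary; an instance of GSIA is any way of making them. **Theorem.** For every SSG $G$, every instance of GSIA terminates and returns a pair of optimal positional strategies. Precisely: there is no infinite execution of GSIA on $G$; and a finite execution can always be continued (the best response in step 2 always exists, and in step 3 a strategy $\sigma'$ exists whatever the choice of $A$) unless it has returned a pair $(\sigma,\tau)$, which is then an optimal pair of positional strategies of $G$. -/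

import Mathlib

open MeasureTheory ProbabilityTheory

noncomputable section

/-- The two players. -/
inductive Player where
  | max
  | min

/-- The four classes of vertices: controlled by one of the players, random, or sink. -/
inductive VertexKind where
  | player (p : Player)
  | random
  | sink

/-- A simple stochastic game on the vertex set `V`. Transition probabilities and sink values are
allowed to be arbitrary real numbers (rational ones are a special case). -/
structure SSG (V : Type*) where
  /-- the partition of the vertices -/
  kind : V → VertexKind
  /-- the arcs of the directed graph -/
  Adj : V → V → Prop
  exists_sink : ∃ s, kind s = VertexKind.sink
  exists_adj : ∀ x, kind x ≠ VertexKind.sink → ∃ y, Adj x y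
  sink_adj : ∀ s, kind s = VertexKind.sink → ∀ y, Adj s y ↔ y = s
  /-- the distribution of the successor of a random vertex -/
  prob : (x : V) → kind x = VertexKind.random → PMF V
  adj_iff_prob_pos : ∀ x (hx : kind x = VertexKind.random) y, Adj x y ↔ 0 < prob x hx y
  /-- the value of a sink -/
  val : (s : V) → kind s = VertexKind.sink → ℝ
  val_mem : ∀ s (hs : kind s = VertexKind.sink), val s hs ∈ Set.Icc (0 : ℝ) 1

/-- Plays are infinite sequences of vertices. -/
abbrev Play (V : Type*) : Type _ := ℕ → V

/-- Finite sequences `(x₀, …, x_k)` of vertices. -/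
abbrev History (V : Type*) (k : ℕ) : Type _ := Finset.Iic k → V

/-- The last vertex of a finite sequence. -/
def History.last {V : Type*} {k : ℕ} (h : History V k) : V := h ⟨k, Finset.mem_Iic.2 le_rfl⟩

namespace SSG

variable {V : Type*} (G : SSG V)

/-- General (history dependent) strategies of a player: to each finite sequence that ends in a
vertex of the player, an outneighbour of that last vertex. (Random plays follow arcs almost surely,
so the choices at sequences that are not directed paths are irrelevant.) -/
def GenStrategy (p : Player) : Type _ :=
  (k : ℕ) → (h : History V k) → G.kind h.last = VertexKind.player p → {y // G.Adj h.last y}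

/-- Positional strategies of a player: an outneighbour of each vertex of the player. -/
def Strategy (p : Player) : Type _ :=
  (x : V) → G.kind x = VertexKind.player p → {y // G.Adj x y}

variable {G} in
/-- A positional strategy as a general strategy, looking at the last vertex only. -/
def Strategy.toGen {p : Player} (σ : G.Strategy p) : G.GenStrategy p :=
  fun _ h hp => σ h.last hp

/-- The distribution of the next vertex of the random play after a given history. -/
def nextPMF (σ : G.GenStrategy Player.max) (τ : G.GenStrategy Player.min) (k : ℕ)
    (h : History V k) : PMF V :=
  match hk : G.kind h.last with
  | VertexKind.player Player.max => PMF.pure (σ k h hk).1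
  | VertexKind.player Player.min => PMF.pure (τ k h hk).1
  | VertexKind.random => G.prob h.last hk
  | VertexKind.sink => PMF.pure h.last

/-- The transition kernels of the random play (for the discrete σ-algebra on the vertices). -/
def stepKernel [Finite V] (σ : G.GenStrategy Player.max) (τ : G.GenStrategy Player.min) (k : ℕ) :
    letI : MeasurableSpace V := ⊤
    Kernel (History V k) V :=
  letI : MeasurableSpace V := ⊤
  Kernel.ofFunOfCountable fun h => (G.nextPMF σ τ k h).toMeasure

instance isMarkovKernel_stepKernel [Finite V] (σ : G.GenStrategy Player.max)
    (τ : G.GenStrategy Player.min) (k : ℕ) :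
    letI : MeasurableSpace V := ⊤
    IsMarkovKernel (G.stepKernel σ τ k) :=
  letI : MeasurableSpace V := ⊤
  ⟨fun h => PMF.toMeasure.isProbabilityMeasure (G.nextPMF σ τ k h)⟩

/-- The law of the random play that starts in `x` and follows `σ` and `τ` (the Ionescu-Tulcea
measure of the transition kernels, on the product of the discrete σ-algebras). -/
def playMeasure [Finite V] (σ : G.GenStrategy Player.max) (τ : G.GenStrategy Player.min) (x : V) :
    letI : MeasurableSpace V := ⊤
    Measure (Play V) :=
  letI : MeasurableSpace V := ⊤
  Kernel.traj (X := fun _ => V) (G.stepKernel σ τ) 0 (fun _ => x)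

open Classical in
/-- The value of a play: the value of the sink it reaches, and `0` if it reaches no sink. -/
def payoff (X : Play V) : ℝ :=
  if h : ∃ t, G.kind (X t) = VertexKind.sink then
    G.val (X (Nat.find h)) (Nat.find_spec h)
  else 0

/-- The value `v_{σ,τ}(x)`, the expected value of the random play. -/
def value [Finite V] (σ : G.GenStrategy Player.max) (τ : G.GenStrategy Player.min) (x : V) : ℝ :=
  letI : MeasurableSpace V := ⊤
  ∫ X, G.payoff X ∂(G.playMeasure σ τ x)

/-- `τ` is a positional best response of MIN to `σ`. -/
def IsBestResponseMin [Finite V] (σ : G.Strategy Player.max) (τ : G.Strategy Player.min) : Prop :=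
  ∀ τ' : G.GenStrategy Player.min, ∀ x, G.value σ.toGen τ.toGen x ≤ G.value σ.toGen τ' x

/-- `σ` is a positional best response of MAX to `τ`. -/
def IsBestResponseMax [Finite V] (τ : G.Strategy Player.min) (σ : G.Strategy Player.max) : Prop :=
  ∀ σ' : G.GenStrategy Player.max, ∀ x, G.value σ' τ.toGen x ≤ G.value σ.toGen τ.toGen x

/-- A pair of optimal strategies: positional strategies that are best responses to each other. -/
def IsOptimalPair [Finite V] (σ : G.Strategy Player.max) (τ : G.Strategy Player.min) : Prop :=
  G.IsBestResponseMin σ τ ∧ G.IsBestResponseMax τ σ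

/-- The value vector `v_σ` of a positional MAX strategy. It is `v_{σ,τ}` for every best response
`τ` to `σ`, see `stratValue_eq`. -/
def stratValue [Finite V] (σ : G.Strategy Player.max) (x : V) : ℝ :=
  ⨅ τ : G.GenStrategy Player.min, G.value σ.toGen τ x

instance [Finite V] (σ : G.GenStrategy Player.max) (τ : G.GenStrategy Player.min) (x : V) :
    letI : MeasurableSpace V := ⊤
    IsProbabilityMeasure (G.playMeasure σ τ x) := by
  let _ : MeasurableSpace V := ⊤
  exact inferInstanceAs
    (IsProbabilityMeasure (Kernel.traj (X := fun _ => V) (G.stepKernel σ τ) 0 (fun _ => x)))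

theorem payoff_mem (X : Play V) : G.payoff X ∈ Set.Icc (0 : ℝ) 1 := by
  unfold payoff
  split_ifs with h
  · exact G.val_mem _ _
  · simp

theorem value_mem [Finite V] (σ : G.GenStrategy Player.max) (τ : G.GenStrategy Player.min)
    (x : V) : G.value σ τ x ∈ Set.Icc (0 : ℝ) 1 := by
  let _ : MeasurableSpace V := ⊤
  refine ⟨integral_nonneg fun X => (G.payoff_mem X).1, ?_⟩
  have h := norm_integral_le_of_norm_le_const (μ := G.playMeasure σ τ x) (C := 1)
    (f := G.payoff) (Filter.Eventually.of_forall fun X => by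
      rw [Real.norm_of_nonneg (G.payoff_mem X).1]
      exact (G.payoff_mem X).2)
  rw [probReal_univ, one_mul, Real.norm_eq_abs] at h
  exact (le_abs_self _).trans h

instance (p : Player) : Nonempty (G.GenStrategy p) :=
  ⟨fun _ _ hp => ⟨_, (G.exists_adj _ (by simp [hp])).choose_spec⟩⟩

theorem stratValue_mem [Finite V] (σ : G.Strategy Player.max) (x : V) :
    G.stratValue σ x ∈ Set.Icc (0 : ℝ) 1 := by
  refine ⟨le_ciInf fun τ => (G.value_mem _ τ x).1, ?_⟩
  obtain ⟨τ⟩ := (inferInstance : Nonempty (G.GenStrategy Player.min))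
  exact (ciInf_le ⟨0, by rintro _ ⟨τ', rfl⟩; exact (G.value_mem _ τ' x).1⟩ τ).trans
    (G.value_mem _ τ x).2

theorem stratValue_eq [Finite V] (σ : G.Strategy Player.max) (τ : G.Strategy Player.min)
    (h : G.IsBestResponseMin σ τ) (x : V) : G.stratValue σ x = G.value σ.toGen τ.toGen x :=
  le_antisymm
    (ciInf_le ⟨0, by rintro _ ⟨τ', rfl⟩; exact (G.value_mem _ τ' x).1⟩ τ.toGen)
    (le_ciInf fun τ' => h τ' x)

/-- `σ' > σ` in `G`. -/
def Better [Finite V] (σ' σ : G.Strategy Player.max) : Prop :=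
  (∀ x, G.stratValue σ x ≤ G.stratValue σ' x) ∧ ∃ x, G.stratValue σ x < G.stratValue σ' x

/-- `σ' ≻ σ` in `G`: `σ' > σ`, and `σ'` agrees with `σ` at all MAX vertices whose value is the
same under both. -/
def StrictlyBetter [Finite V] (σ' σ : G.Strategy Player.max) : Prop :=
  G.Better σ' σ ∧ ∀ x (hx : G.kind x = VertexKind.player Player.max),
    G.stratValue σ' x = G.stratValue σ x → σ' x hx = σ x hx

/-- The arcs of `G`. -/
abbrev Arc : Type _ := {e : V × V // G.Adj e.1 e.2}

variable {G} in
open Classical in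
/-- The new end of the arc from `x` to `y`: the new sink `s_e` if `e = (x, y)` is in `A`, and `y`
otherwise. The loop of a sink is left in place, so that the sink stays a sink. -/
def reroute (A : Set G.Arc) (x y : V) : V ⊕ A :=
  if h : G.kind x ≠ VertexKind.sink ∧ ∃ hxy : G.Adj x y, (⟨(x, y), hxy⟩ : G.Arc) ∈ A then
    Sum.inr ⟨⟨(x, y), h.2.choose⟩, h.2.choose_spec⟩
  else Sum.inl y

/-- The transformed game `G[A, f]`. -/
def transform (A : Set G.Arc) (f : A → ℝ) (hf : ∀ e, f e ∈ Set.Icc (0 : ℝ) 1) : SSG (V ⊕ A) where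
  kind := Sum.elim G.kind fun _ => VertexKind.sink
  Adj
    | Sum.inl x, z => ∃ y, G.Adj x y ∧ z = reroute A x y
    | Sum.inr e, z => z = Sum.inr e
  exists_sink := by
    obtain ⟨s, hs⟩ := G.exists_sink
    exact ⟨Sum.inl s, hs⟩
  exists_adj := by
    rintro (x | e) h
    · obtain ⟨y, hy⟩ := G.exists_adj x h
      exact ⟨_, y, hy, rfl⟩
    · exact ⟨_, rfl⟩
  sink_adj := by
    rintro (s | e) hs z
    · have hs' : G.kind s = VertexKind.sink := hs
      simp [G.sink_adj s hs', reroute, hs']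
    · rfl
  prob
    | Sum.inl x, hx => (G.prob x hx).map (reroute A x)
    | Sum.inr _, hx => nomatch hx
  adj_iff_prob_pos := by
    rintro (x | e) hx z
    · have hx' : G.kind x = VertexKind.random := hx
      change (∃ y, G.Adj x y ∧ z = reroute A x y) ↔ 0 < (G.prob x hx').map (reroute A x) z
      rw [pos_iff_ne_zero, ← PMF.mem_support_iff, PMF.support_map]
      simp [G.adj_iff_prob_pos x hx', pos_iff_ne_zero, eq_comm]
    · nomatch hx
  val
    | Sum.inl s, hs => G.val s hs
    | Sum.inr e, _ => f e
  val_mem := by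
    rintro (s | e) hs
    · exact G.val_mem s hs
    · exact hf e

/-- The transformed game `G[A, σ]`: the new sink of the arc `(x, y)` has the value `v_σ(y)`. -/
def transformStrat [Finite V] (A : Set G.Arc) (σ : G.Strategy Player.max) : SSG (V ⊕ A) :=
  G.transform A (fun e => G.stratValue σ e.1.1.2) fun e => G.stratValue_mem σ e.1.1.2

/-- A positional strategy of `G`, interpreted as a strategy of `G[A, σ]`. -/
def lift [Finite V] (A : Set G.Arc) (σ : G.Strategy Player.max) {p : Player} (ρ : G.Strategy p) :
    (G.transformStrat A σ).Strategy p
  | Sum.inl x, hx => ⟨reroute A x (ρ x hx).1, (ρ x hx).1, (ρ x hx).2, rfl⟩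
  | Sum.inr _, hx => nomatch hx

/-- The states of the generic strategy improvement algorithm on `G`. -/
inductive GSIAState : Type _ where
  /-- before the choice of the initial strategy -/
  | start : GSIAState
  /-- at the test of the loop, with the current strategy `σ` -/
  | test (σ : G.Strategy Player.max) : GSIAState
  /-- in the loop, after the choice of `A` and before the search for `σ'` -/
  | improve (σ : G.Strategy Player.max) (A : Set G.Arc) : GSIAState
  /-- the algorithm has returned `(σ, τ)` -/
  | halt (σ : G.Strategy Player.max) (τ : G.Strategy Player.min) : GSIAState

/-- The steps of the generic strategy improvement algorithm. The choices that an instance of the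
algorithm has to make are left open here: the executions of all instances are exactly the sequences
of such steps. -/
inductive GSIAStep [Finite V] : G.GSIAState → G.GSIAState → Prop where
  | init (σ : G.Strategy Player.max) : GSIAStep .start (.test σ)
  | exit (σ : G.Strategy Player.max) (τ : G.Strategy Player.min)
      (hτ : G.IsBestResponseMin σ τ) (h : G.IsOptimalPair σ τ) : GSIAStep (.test σ) (.halt σ τ)
  | choose (σ : G.Strategy Player.max) (τ : G.Strategy Player.min)
      (hτ : G.IsBestResponseMin σ τ) (h : ¬ G.IsOptimalPair σ τ) (A : Set G.Arc) :
      GSIAStep (.test σ) (.improve σ A)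
  | update (σ σ' : G.Strategy Player.max) (A : Set G.Arc)
      (h : (G.transformStrat A σ).StrictlyBetter (G.lift A σ σ') (G.lift A σ σ)) :
      GSIAStep (.improve σ A) (.test σ')

end SSG

end

/-! Termination: each round strictly increases the value vector of the positional MAX strategy, and
there are finitely many such strategies. The core is `Better.of_transformStrat`. Let v be the value
vector of σ, which the transformation preserves (`stratValue_lift_self`), let w be that of σ' in
G[A,σ] and u that of σ' in G. By assumption v ≤ w; the claim is w ≤ u. If w - u had a positive
maximum, the set S where it is attained would contain no sink and be closed under σ' and a best
response τ to σ' in G. In a stopping game this is already absurd. In general one uses that a closed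
set without sinks forces value 0 (`stratValue_nonpos_of_closed`), twice. On the part of S where w =
v, the agreement clause of ≻ gives σ' = σ, so this part would be closed under σ and v would vanish
on it, although w > u ≥ 0 there. Hence w > v on S. Then no arc used inside S is rerouted, S is
closed in G[A,σ] as well, and w vanishes on S, a contradiction.

Progress: if no MAX vertex has a successor of larger v, then v bounds what any MAX strategy gains
against the best response, so the pair is optimal (`exists_switch`). Otherwise a single switch
improves σ in every G[A,σ] (`exists_strictlyBetter`).

Since stopping is not assumed, the optimality equations may have several solutions. The value vector
is the least one above the sink values, the limit of value iteration from the sink values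
(`exists_solution`). -/

noncomputable section

/-! ### Expectations under distributions on a finite set -/

section Expect

variable {V : Type*} [Finite V]

/-- The expectation of a real function under a distribution on a finite set. -/
def expect (q : PMF V) (f : V → ℝ) : ℝ :=
  letI := Fintype.ofFinite V
  ∑ y, (q y).toReal * f y

theorem expect_mono (q : PMF V) {f g : V → ℝ} (h : ∀ y, f y ≤ g y) : expect q f ≤ expect q g :=
  Finset.sum_le_sum fun y _ => mul_le_mul_of_nonneg_left (h y) ENNReal.toReal_nonneg

theorem expect_sub (q : PMF V) (f g : V → ℝ) :
    expect q (fun y => f y - g y) = expect q f - expect q g := by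
  simp [expect, mul_sub, Finset.sum_sub_distrib]

theorem expect_const (q : PMF V) (c : ℝ) : expect q (fun _ => c) = c := by
  let _ := Fintype.ofFinite V
  have h : ∑ y, (q y).toReal = 1 := by
    rw [← ENNReal.toReal_sum fun y _ => q.apply_ne_top y, ← tsum_fintype (L := .unconditional V),
      q.tsum_coe, ENNReal.toReal_one]
  rw [expect, ← Finset.sum_mul, h, one_mul]

theorem expect_pure (x : V) (f : V → ℝ) : expect (PMF.pure x) f = f x := by
  let _ := Fintype.ofFinite V
  rw [expect, Finset.sum_eq_single x] <;> simp +contextual [PMF.pure_apply]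

theorem expect_eq_integral (q : PMF V) (f : V → ℝ) :
    letI : MeasurableSpace V := ⊤
    ∫ y, f y ∂q.toMeasure = expect q f := by
  let _ := Fintype.ofFinite V
  let _ : MeasurableSpace V := ⊤
  simp [PMF.integral_eq_sum, expect]

theorem expect_congr (q : PMF V) {f g : V → ℝ} (h : ∀ y ∈ q.support, f y = g y) :
    expect q f = expect q g := by
  refine Finset.sum_congr rfl fun y _ => ?_
  by_cases hy : y ∈ q.support
  · rw [h y hy]
  · rw [PMF.mem_support_iff, not_not] at hy
    simp [hy]

theorem expect_map {W : Type*} [Finite W] (q : PMF V) (φ : V → W) (f : W → ℝ) :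
    expect (q.map φ) f = expect q (fun y => f (φ y)) := by
  let _ : MeasurableSpace V := ⊤
  let _ : MeasurableSpace W := ⊤
  have hφ : Measurable φ := fun _ _ => trivial
  rw [← expect_eq_integral, ← expect_eq_integral, ← PMF.toMeasure_map φ q hφ,
    integral_map hφ.aemeasurable]
  exact Measurable.aestronglyMeasurable fun _ _ => trivial

/-- A function that attains its upper bound in the mean equals this bound on the support. -/
theorem eq_of_le_expect (q : PMF V) {f : V → ℝ} {d : ℝ} (hf : ∀ y, f y ≤ d) (h : d ≤ expect q f)
    {y : V} (hy : y ∈ q.support) : f y = d := by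
  let _ := Fintype.ofFinite V
  have h0 : expect q (fun y => d - f y) = 0 := by
    refine le_antisymm ?_ (Finset.sum_nonneg fun y _ =>
      mul_nonneg ENNReal.toReal_nonneg (sub_nonneg.2 (hf y)))
    rw [expect_sub, expect_const]
    linarith
  have h1 := (Finset.sum_eq_zero_iff_of_nonneg fun y _ =>
    mul_nonneg ENNReal.toReal_nonneg (sub_nonneg.2 (hf y))).1 h0 y (Finset.mem_univ y)
  have h2 : (q y).toReal ≠ 0 := ENNReal.toReal_ne_zero.2 ⟨hy, q.apply_ne_top y⟩
  rcases mul_eq_zero.1 h1 with h3 | h3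
  · exact absurd h3 h2
  · linarith

end Expect

/-! ### The law of the random play and bounds on its value -/

namespace SSG

variable {V : Type*} (G : SSG V)

/-- The value of a sink, and `0` at all other vertices. -/
def sinkVal (x : V) : ℝ :=
  letI := Classical.propDecidable
  if h : G.kind x = VertexKind.sink then G.val x h else 0

theorem sinkVal_mem (x : V) : G.sinkVal x ∈ Set.Icc (0 : ℝ) 1 := by
  unfold sinkVal
  split_ifs
  · exact G.val_mem _ _
  · simp

section Law

variable [Finite V] (σ : G.GenStrategy Player.max) (τ : G.GenStrategy Player.min) (x : V)

/-- The joint law of a history and the next vertex is the law of the history composed with the step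
kernel. Transition probabilities enter the later proofs only through this identity. -/
theorem integral_step (k : ℕ) (F : History V k → V → ℝ) :
    letI : MeasurableSpace V := ⊤
    ∫ X, F (Preorder.frestrictLe k X) (X (k + 1)) ∂G.playMeasure σ τ x =
      ∫ X, expect (G.nextPMF σ τ k (Preorder.frestrictLe k X)) (F (Preorder.frestrictLe k X))
        ∂G.playMeasure σ τ x := by
  let _ : MeasurableSpace V := ⊤
  have h := Kernel.partialTraj_compProd_eq_map_traj (X := fun _ => V) (κ := G.stepKernel σ τ)
    (Nat.zero_le k) (x₀ := fun _ => x)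
  have h1 : ∫ z, F z.1 z.2 ∂((Kernel.traj (X := fun _ => V) (G.stepKernel σ τ) 0 (fun _ => x)).map
      (fun X => (Preorder.frestrictLe k X, X (k + 1)))) =
      ∫ X, F (Preorder.frestrictLe k X) (X (k + 1)) ∂G.playMeasure σ τ x := by
    rw [integral_map (by fun_prop) (StronglyMeasurable.of_discrete.aestronglyMeasurable)]
    rfl
  rw [← h1, ← h, Measure.integral_compProd .of_finite, ← Kernel.traj_map_frestrictLe_apply,
    integral_map (by fun_prop) (StronglyMeasurable.of_discrete.aestronglyMeasurable)]
  refine integral_congr_ae (Filter.Eventually.of_forall fun X => ?_)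
  exact expect_eq_integral _ _

end Law

end SSG

theorem exists_abs_le_of_finite {α : Type*} [Finite α] (f : α → ℝ) : ∃ C, ∀ a, |f a| ≤ C := by
  obtain ⟨C, hC⟩ := (Set.finite_range fun a => |f a|).bddAbove
  exact ⟨C, fun a => hC ⟨a, rfl⟩⟩

namespace SSG

variable {V : Type*} (G : SSG V)

theorem sinkVal_of_sink {x : V} (h : G.kind x = VertexKind.sink) : G.sinkVal x = G.val x h :=
  dif_pos h

theorem sinkVal_of_not_sink {x : V} (h : G.kind x ≠ VertexKind.sink) : G.sinkVal x = 0 :=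
  dif_neg h

theorem nextPMF_of_sink (σ : G.GenStrategy Player.max) (τ : G.GenStrategy Player.min) {k : ℕ}
    (h : History V k) (hk : G.kind h.last = VertexKind.sink) :
    G.nextPMF σ τ k h = PMF.pure h.last := by
  unfold nextPMF
  split <;> simp_all

/-- On plays that stay in the first sink that they reach, the payoff is the eventual value of
`sinkVal` along the play. -/
theorem payoff_of_absorbed {G : SSG V} {X : Play V}
    (hX : ∀ k, G.kind (X k) = VertexKind.sink → X (k + 1) = X k) :
    (∀ k, G.sinkVal (X k) ≤ G.payoff X) ∧ ∀ᶠ k in Filter.atTop, G.sinkVal (X k) = G.payoff X := by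
  classical
  by_cases h : ∃ t, G.kind (X t) = VertexKind.sink
  · have hs := Nat.find_spec h
    have hp : G.payoff X = G.sinkVal (X (Nat.find h)) := by
      rw [G.sinkVal_of_sink hs]
      exact dif_pos h
    have hc : ∀ n, X (Nat.find h + n) = X (Nat.find h) := fun n => by
      induction n with
      | zero => rfl
      | succ n ih => rw [← add_assoc, hX _ (ih ▸ hs), ih]
    have hge : ∀ k ≥ Nat.find h, G.sinkVal (X k) = G.payoff X := fun k hk => by
      obtain ⟨n, rfl⟩ := Nat.exists_eq_add_of_le hk
      rw [hc, hp]
    refine ⟨fun k => ?_, Filter.eventually_atTop.2 ⟨_, hge⟩⟩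
    rcases lt_or_ge k (Nat.find h) with hk | hk
    · rw [G.sinkVal_of_not_sink (Nat.find_min h hk)]
      exact (G.payoff_mem X).1
    · exact (hge k hk).le
  · have hp : G.payoff X = 0 := dif_neg h
    have h0 : ∀ k, G.sinkVal (X k) = G.payoff X := fun k => by
      rw [G.sinkVal_of_not_sink fun hk => h ⟨k, hk⟩, hp]
    exact ⟨fun k => (h0 k).le, Filter.Eventually.of_forall h0⟩

section Law

variable [Finite V] (σ : G.GenStrategy Player.max) (τ : G.GenStrategy Player.min) (x : V)

theorem ae_absorbed :
    letI : MeasurableSpace V := ⊤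
    ∀ᵐ X ∂G.playMeasure σ τ x,
      ∀ k, G.kind (X k) = VertexKind.sink → X (k + 1) = X k := by
  classical
  let _ : MeasurableSpace V := ⊤
  refine ae_all_iff.2 fun k => ?_
  -- The indicator of leaving a sink at time `k`; its conditional mean given the history is zero.
  let F : History V k → V → ℝ := fun h y =>
    if G.kind h.last = VertexKind.sink ∧ y ≠ h.last then 1 else 0
  have h := G.integral_step σ τ x k F
  have h0 : ∀ h, expect (G.nextPMF σ τ k h) (F h) = 0 := fun h => by
    by_cases hh : G.kind h.last = VertexKind.sink
    · rw [G.nextPMF_of_sink σ τ h hh, expect_pure]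
      simp [F]
    · simp [F, hh, expect_const]
  simp only [h0, integral_zero] at h
  have hm : Measurable fun X : Play V => F (Preorder.frestrictLe k X) (X (k + 1)) :=
    (Measurable.of_discrete (f := Function.uncurry F)).comp
      (g := F.uncurry) (f := fun X : Play V => (Preorder.frestrictLe k X, X (k + 1))) (by fun_prop)
  have hF : ∀ a b, F a b ∈ Set.Icc (0 : ℝ) 1 := fun a b => by
    simp only [F]
    split_ifs <;> simp
  have hi : Integrable (fun X : Play V => F (Preorder.frestrictLe k X) (X (k + 1)))
      (G.playMeasure σ τ x) :=
    Integrable.of_mem_Icc 0 1 hm.aemeasurable (Filter.Eventually.of_forall fun X => hF _ _)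
  rw [integral_eq_zero_iff_of_nonneg (fun X => (hF _ _).1) hi] at h
  filter_upwards [h] with X hX hs
  by_contra hne
  have : F (Preorder.frestrictLe k X) (X (k + 1)) = 1 := if_pos ⟨hs, hne⟩
  rw [this] at hX
  exact one_ne_zero hX

theorem integrable_eval (w : V → ℝ) (k : ℕ) :
    letI : MeasurableSpace V := ⊤
    Integrable (fun X : Play V => w (X k)) (G.playMeasure σ τ x) := by
  let _ : MeasurableSpace V := ⊤
  obtain ⟨C, hC⟩ := exists_abs_le_of_finite w
  refine Integrable.of_bound ((Measurable.of_discrete (f := w)).comp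
    (measurable_pi_apply k)).aestronglyMeasurable C (Filter.Eventually.of_forall fun X => hC _)

theorem integral_eval_zero (w : V → ℝ) :
    letI : MeasurableSpace V := ⊤
    ∫ X, w (X 0) ∂G.playMeasure σ τ x = w x := by
  let _ : MeasurableSpace V := ⊤
  have h := Kernel.traj_map_frestrictLe_apply (X := fun _ => V) (κ := G.stepKernel σ τ)
    0 0 (fun _ => x)
  rw [Kernel.partialTraj_self, Kernel.id_apply] at h
  have h1 : ∫ h, w (History.last h) ∂((Kernel.traj (X := fun _ => V) (G.stepKernel σ τ) 0
      (fun _ => x)).map (Preorder.frestrictLe 0)) = ∫ X, w (X 0) ∂G.playMeasure σ τ x := by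
    rw [integral_map (by fun_prop) (StronglyMeasurable.of_discrete.aestronglyMeasurable)]
    rfl
  rw [← h1, h, integral_dirac]
  rfl

theorem integral_eval_succ (w : V → ℝ) (k : ℕ) :
    letI : MeasurableSpace V := ⊤
    ∫ X, w (X (k + 1)) ∂G.playMeasure σ τ x =
      ∫ X, expect (G.nextPMF σ τ k (Preorder.frestrictLe k X)) w ∂G.playMeasure σ τ x :=
  G.integral_step σ τ x k fun _ => w

theorem integrable_step (w : V → ℝ) (k : ℕ) :
    letI : MeasurableSpace V := ⊤
    Integrable (fun X : Play V => expect (G.nextPMF σ τ k (Preorder.frestrictLe k X)) w)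
      (G.playMeasure σ τ x) := by
  let _ : MeasurableSpace V := ⊤
  obtain ⟨C, hC⟩ := exists_abs_le_of_finite fun h : History V k => expect (G.nextPMF σ τ k h) w
  refine Integrable.of_bound ((Measurable.of_discrete
    (f := fun h : History V k => expect (G.nextPMF σ τ k h) w)).comp
    (Preorder.measurable_frestrictLe k)).aestronglyMeasurable _
    (Filter.Eventually.of_forall fun X => hC _)

/-- Almost surely `sinkVal (X k)` is eventually equal to the payoff, and it is bounded by 1. This
reduces the value to expectations of functions of a single vertex. -/
theorem tendsto_integral_sinkVal :
    letI : MeasurableSpace V := ⊤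
    Filter.Tendsto (fun k => ∫ X, G.sinkVal (X k) ∂G.playMeasure σ τ x) Filter.atTop
      (nhds (G.value σ τ x)) := by
  let _ : MeasurableSpace V := ⊤
  refine tendsto_integral_of_dominated_convergence (fun _ => 1)
    (fun k => (G.integrable_eval σ τ x G.sinkVal k).aestronglyMeasurable) (integrable_const _)
    (fun k => Filter.Eventually.of_forall fun X => ?_) ?_
  · rw [Real.norm_of_nonneg (G.sinkVal_mem _).1]
    exact (G.sinkVal_mem _).2
  · filter_upwards [G.ae_absorbed σ τ x] with X hX
    exact tendsto_const_nhds.congr'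
      ((payoff_of_absorbed hX).2.mono fun k hk => hk.symm)

/-- A supersolution along all histories bounds the value from above. -/
theorem value_le_of_step_le {w : V → ℝ} (hw : ∀ y, G.sinkVal y ≤ w y)
    (h : ∀ k (h : History V k), expect (G.nextPMF σ τ k h) w ≤ w h.last) :
    G.value σ τ x ≤ w x := by
  let _ : MeasurableSpace V := ⊤
  -- `w (X k)` is a supermartingale.
  have h1 : ∀ k, ∫ X, w (X k) ∂G.playMeasure σ τ x ≤ w x := fun k => by
    induction k with
    | zero => exact (G.integral_eval_zero σ τ x w).le
    | succ k ih =>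
      refine le_trans ?_ ih
      rw [G.integral_eval_succ]
      exact integral_mono (G.integrable_step σ τ x w k) (G.integrable_eval σ τ x w k)
        fun X => h k (Preorder.frestrictLe k X)
  refine le_of_tendsto' (G.tendsto_integral_sinkVal σ τ x) fun k => le_trans ?_ (h1 k)
  exact integral_mono (G.integrable_eval σ τ x _ k) (G.integrable_eval σ τ x w k)
    fun X => hw (X k)

/-- A sequence of successive subsolutions that starts from the sink values bounds the value from
below. -/
theorem le_value_of_le_step {w : ℕ → V → ℝ} (hw : ∀ y, w 0 y ≤ G.sinkVal y)
    (h : ∀ n k (h : History V k), w (n + 1) h.last ≤ expect (G.nextPMF σ τ k h) (w n)) (n : ℕ) :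
    w n x ≤ G.value σ τ x := by
  let _ : MeasurableSpace V := ⊤
  -- Each step of the play uses up one iterate, so `j` has to vary in the induction.
  have h1 : ∀ k j, w (k + j) x ≤ ∫ X, w j (X k) ∂G.playMeasure σ τ x := fun k => by
    induction k with
    | zero => exact fun j => by rw [zero_add]; exact (G.integral_eval_zero σ τ x (w j)).ge
    | succ k ih =>
      intro j
      have := ih (j + 1)
      rw [show k + 1 + j = k + (j + 1) by ring, G.integral_eval_succ]
      exact this.trans (integral_mono (G.integrable_eval σ τ x _ k)
        (G.integrable_step σ τ x _ k) fun X => h j k (Preorder.frestrictLe k X))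
  refine (h1 n 0).trans (integral_mono_ae (g := G.payoff) (G.integrable_eval σ τ x _ n) ?_ ?_)
  -- The payoff is measurable as an almost sure limit of the functions `sinkVal (X k)`.
  · refine ⟨aestronglyMeasurable_of_tendsto_ae Filter.atTop (fun k =>
      (G.integrable_eval σ τ x G.sinkVal k).aestronglyMeasurable) ?_, ?_⟩
    · filter_upwards [G.ae_absorbed σ τ x] with X hX
      exact tendsto_const_nhds.congr' ((payoff_of_absorbed hX).2.mono fun k hk => hk.symm)
    · exact HasFiniteIntegral.of_bounded (C := 1) (Filter.Eventually.of_forall fun X => by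
        rw [Real.norm_of_nonneg (G.payoff_mem X).1]
        exact (G.payoff_mem X).2)
  · filter_upwards [G.ae_absorbed σ τ x] with X hX
    exact (hw _).trans ((payoff_of_absorbed hX).1 n)

end Law

end SSG

/-! ### Value iteration and the value vector of a positional MAX strategy -/

/-- The iterates of an optimality operator, started from a subsolution, and their limit. -/
theorem exists_limit_of_iterates {V ι : Type*} [Finite V] [Finite ι] [Nonempty ι]
    (m : ι → V → PMF V) {g : V → ℝ} (hg1 : ∀ x, g x ≤ 1)
    (hg : ∀ i x, g x ≤ expect (m i x) g) :
    ∃ (w : ℕ → V → ℝ) (v : V → ℝ), w 0 = g ∧ (∀ n x i, w (n + 1) x ≤ expect (m i x) (w n)) ∧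
      (∀ n x, w n x ≤ v x) ∧ (∀ x c, (∀ n, w n x ≤ c) → v x ≤ c) ∧
      (∀ i x, v x ≤ expect (m i x) v) ∧ ∀ x, ∃ i, expect (m i x) v ≤ v x := by
  let T : (V → ℝ) → V → ℝ := fun f x => ⨅ i, expect (m i x) f
  let w : ℕ → V → ℝ := fun n => T^[n] g
  have hsucc : ∀ n, w (n + 1) = T (w n) := fun n => Function.iterate_succ_apply' T n g
  have hT : ∀ f x i, T f x ≤ expect (m i x) f := fun f x i =>
    ciInf_le (Finite.bddBelow_range _) i
  have hmono : Monotone w := by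
    refine monotone_nat_of_le_succ fun n => ?_
    induction n with
    | zero => exact fun x => le_ciInf fun i => hg i x
    | succ n ih =>
      rw [hsucc, hsucc (n + 1)]
      exact fun x => le_ciInf fun i => (hT _ x i).trans (expect_mono _ ih)
  have hle : ∀ n x, w n x ≤ 1 := fun n => by
    induction n with
    | zero => exact hg1
    | succ n ih =>
      intro x
      rw [hsucc]
      exact (hT _ x (Classical.arbitrary ι)).trans
        ((expect_mono _ ih).trans (expect_const _ 1).le)
  have hbdd : ∀ x, BddAbove (Set.range fun n => w n x) := fun x =>
    ⟨1, by rintro _ ⟨n, rfl⟩; exact hle n x⟩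
  let v : V → ℝ := fun x => ⨆ n, w n x
  have hv : ∀ n x, w n x ≤ v x := fun n x => le_ciSup (hbdd x) n
  have hlim : ∀ x, Filter.Tendsto (fun n => w n x) Filter.atTop (nhds (v x)) := fun x =>
    tendsto_atTop_ciSup (fun _ _ h => hmono h x) (hbdd x)
  have hstep : ∀ n x i, w (n + 1) x ≤ expect (m i x) (w n) := fun n x i => by
    rw [hsucc]
    exact hT _ x i
  refine ⟨w, v, rfl, hstep, hv, fun x c hc => ciSup_le hc, fun i x => ?_, fun x => ?_⟩
  · refine ciSup_le fun n => ?_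
    exact (hmono n.le_succ x).trans ((hstep n x i).trans (expect_mono _ (hv n)))
  -- As there are finitely many `i`, one `n` makes all expectations of `w n` exceed `v x`; then `w
  -- (n + 1) x > v x`.
  · by_contra! hcon
    have hexp : ∀ i, Filter.Tendsto (fun n => expect (m i x) (w n)) Filter.atTop
        (nhds (expect (m i x) v)) := fun i =>
      tendsto_finsetSum _ fun y _ => (hlim y).const_mul _
    obtain ⟨n, hn⟩ := (Filter.eventually_all.2 fun i =>
      (hexp i).eventually_const_lt (hcon i)).exists
    obtain ⟨i, hi⟩ := exists_eq_ciInf_of_finite (f := fun i => expect (m i x) (w n))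
    have h1 := hv (n + 1) x
    rw [hsucc] at h1
    exact absurd (hi ▸ hn i : v x < ⨅ i, expect (m i x) (w n)) (not_lt.2 h1)

namespace SSG

variable {V : Type*} (G : SSG V)

section Moves

variable (σ : G.GenStrategy Player.max) (τ : G.GenStrategy Player.min) {k : ℕ} (h : History V k)

theorem nextPMF_of_max (hk : G.kind h.last = VertexKind.player Player.max) :
    G.nextPMF σ τ k h = PMF.pure (σ k h hk).1 := by
  unfold nextPMF
  split <;> first | rfl | (rename_i h'; cases hk.symm.trans h')

theorem nextPMF_of_min (hk : G.kind h.last = VertexKind.player Player.min) :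
    G.nextPMF σ τ k h = PMF.pure (τ k h hk).1 := by
  unfold nextPMF
  split <;> first | rfl | (rename_i h'; cases hk.symm.trans h')

theorem nextPMF_of_random (hk : G.kind h.last = VertexKind.random) :
    G.nextPMF σ τ k h = G.prob h.last hk := by
  unfold nextPMF
  split <;> first | rfl | (rename_i h'; cases hk.symm.trans h')

end Moves

/-- The distribution of the successor of a vertex under positional strategies. -/
def move (σ : G.Strategy Player.max) (τ : G.Strategy Player.min) (x : V) : PMF V :=
  G.nextPMF σ.toGen τ.toGen 0 fun _ => x

section Move

variable (σ : G.Strategy Player.max) (τ : G.Strategy Player.min) {x : V}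

theorem move_max (hx : G.kind x = VertexKind.player Player.max) :
    G.move σ τ x = PMF.pure (σ x hx).1 :=
  G.nextPMF_of_max _ _ (k := 0) (fun _ => x) hx

theorem move_min (hx : G.kind x = VertexKind.player Player.min) :
    G.move σ τ x = PMF.pure (τ x hx).1 :=
  G.nextPMF_of_min _ _ (k := 0) (fun _ => x) hx

theorem move_random (hx : G.kind x = VertexKind.random) : G.move σ τ x = G.prob x hx :=
  G.nextPMF_of_random _ _ (k := 0) (fun _ => x) hx

theorem move_sink (hx : G.kind x = VertexKind.sink) : G.move σ τ x = PMF.pure x :=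
  G.nextPMF_of_sink _ _ (k := 0) (fun _ => x) hx

variable {G σ τ} in
theorem move_congr {σ' : G.Strategy Player.max} {τ' : G.Strategy Player.min}
    (hσ : ∀ hx, σ x hx = σ' x hx) (hτ : ∀ hx, τ x hx = τ' x hx) :
    G.move σ τ x = G.move σ' τ' x := by
  rcases hx : G.kind x with (_ | _) | _ | _
  · rw [move_max _ _ _ hx, move_max _ _ _ hx, hσ]
  · rw [move_min _ _ _ hx, move_min _ _ _ hx, hτ]
  · rw [move_random _ _ _ hx, move_random _ _ _ hx]
  · rw [move_sink _ _ _ hx, move_sink _ _ _ hx]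

theorem sinkVal_le_expect_move [Finite V] (x : V) :
    G.sinkVal x ≤ expect (G.move σ τ x) G.sinkVal := by
  by_cases hx : G.kind x = VertexKind.sink
  · rw [G.move_sink _ _ hx, expect_pure]
  · rw [G.sinkVal_of_not_sink hx, ← expect_const (G.move σ τ x) 0]
    exact expect_mono _ fun y => (G.sinkVal_mem y).1

instance (p : Player) : Nonempty (G.Strategy p) :=
  ⟨fun _ hp => ⟨_, (G.exists_adj _ (by simp [hp])).choose_spec⟩⟩

instance [Finite V] (p : Player) : Finite (G.Strategy p) := by
  unfold Strategy
  infer_instance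

variable {G} in
theorem exists_strategy_update {p : Player} (ρ : G.Strategy p) (x : V)
    (c : G.kind x = VertexKind.player p → {y // G.Adj x y}) :
    ∃ ρ' : G.Strategy p, ρ' x = c ∧ ∀ y ≠ x, ρ' y = ρ y := by
  classical
  exact ⟨Function.update (β := fun y => G.kind y = VertexKind.player p → {z // G.Adj y z}) ρ x c,
    Function.update_self .., fun _ hy => Function.update_of_ne hy ..⟩

/-- After a given history, a general strategy of MIN behaves like a positional one. -/
theorem exists_nextPMF_eq_move (τ : G.GenStrategy Player.min) {k : ℕ} (h : History V k) :
    ∃ τ', G.nextPMF σ.toGen τ k h = G.move σ τ' h.last := by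
  obtain ⟨τ₀⟩ := (inferInstance : Nonempty (G.Strategy Player.min))
  obtain ⟨τ', hτ', -⟩ := exists_strategy_update τ₀ h.last (τ k h)
  refine ⟨τ', ?_⟩
  rcases hx : G.kind h.last with (_ | _) | _ | _
  · exact (G.nextPMF_of_max _ _ _ hx).trans (G.move_max σ τ' hx).symm
  · refine (G.nextPMF_of_min _ _ _ hx).trans ((G.move_min σ τ' hx).trans ?_).symm
    rw [hτ']
  · exact (G.nextPMF_of_random _ _ _ hx).trans (G.move_random σ τ' hx).symm
  · exact (G.nextPMF_of_sink _ _ _ hx).trans (G.move_sink σ τ' hx).symm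

end Move

section Value

variable [Finite V] (σ : G.Strategy Player.max)

theorem value_le_of_supersolution (τ : G.Strategy Player.min) {w : V → ℝ}
    (hw : ∀ y, G.sinkVal y ≤ w y) (h : ∀ y, expect (G.move σ τ y) w ≤ w y) (x : V) :
    G.value σ.toGen τ.toGen x ≤ w x :=
  G.value_le_of_step_le _ _ x hw fun _ h' => h h'.last

/-- Value iteration with MIN restricted to the moves of the family `t`. It is used with a single
strategy, to get the equation for a fixed pair, and with all strategies, to get a best response. -/
theorem exists_solution {ι : Type*} [Finite ι] [Nonempty ι] (t : ι → G.Strategy Player.min) :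
    ∃ v : V → ℝ, (∀ x, G.sinkVal x ≤ v x) ∧ (∀ i x, v x ≤ expect (G.move σ (t i) x) v) ∧
      (∀ x, ∃ i, expect (G.move σ (t i) x) v ≤ v x) ∧
      ∀ τ : G.GenStrategy Player.min, (∀ k (h : History V k),
        ∃ i, G.nextPMF σ.toGen τ k h = G.move σ (t i) h.last) → ∀ x, v x ≤ G.value σ.toGen τ x := by
  obtain ⟨w, v, h0, hstep, hv, hlub, hsub, hsup⟩ :=
    exists_limit_of_iterates (fun i => G.move σ (t i)) (g := G.sinkVal)
      (fun x => (G.sinkVal_mem x).2) fun i x => G.sinkVal_le_expect_move σ (t i) x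
  refine ⟨v, fun x => h0 ▸ hv 0 x, hsub, hsup, fun τ hτ x => hlub x _ fun n => ?_⟩
  refine G.le_value_of_le_step _ τ x (fun y => (congrFun h0 y).le) (fun n k h => ?_) n
  obtain ⟨i, hi⟩ := hτ k h
  rw [hi]
  exact hstep n _ i

theorem value_eq_expect (τ : G.Strategy Player.min) (x : V) :
    G.value σ.toGen τ.toGen x = expect (G.move σ τ x) (G.value σ.toGen τ.toGen) := by
  obtain ⟨v, hg, hsub, hsup, hv⟩ := G.exists_solution σ fun _ : Unit => τ
  have h : G.value σ.toGen τ.toGen = v := funext fun x => le_antisymm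
    (G.value_le_of_supersolution σ τ hg (fun y => (hsup y).choose_spec) x)
    (hv _ (fun k h => ⟨(), rfl⟩) x)
  rw [h]
  exact le_antisymm (hsub () x) (hsup x).choose_spec

theorem exists_isBestResponseMin_and_le_expect :
    ∃ τ, G.IsBestResponseMin σ τ ∧
      ∀ τ' x, G.stratValue σ x ≤ expect (G.move σ τ' x) (G.stratValue σ) := by
  obtain ⟨v, hg, hsub, hsup, hv⟩ := G.exists_solution σ (id : G.Strategy Player.min → _)
  choose t ht using hsup
  have hle : ∀ τ x, v x ≤ G.value σ.toGen τ x := fun τ =>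
    hv τ fun k h => G.exists_nextPMF_eq_move σ τ h
  -- Diagonal choice: `t x` attains the minimum at `x`, and only its move at `x` matters.
  have hval : ∀ x, G.value σ.toGen (Strategy.toGen fun x => t x x) x ≤ v x :=
    G.value_le_of_supersolution σ (fun x => t x x) hg fun y =>
      (congrArg (expect · v) (move_congr (fun _ => rfl) fun _ => rfl)).trans_le (ht y)
  have hbest : G.IsBestResponseMin σ fun x => t x x := fun τ' x => (hval x).trans (hle τ' x)
  have h : G.stratValue σ = v := funext fun x =>
    (G.stratValue_eq σ _ hbest x).trans (le_antisymm (hval x) (hle _ x))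
  exact ⟨_, hbest, h ▸ hsub⟩

theorem exists_isBestResponseMin : ∃ τ, G.IsBestResponseMin σ τ :=
  (G.exists_isBestResponseMin_and_le_expect σ).imp fun _ h => h.1

theorem stratValue_le_expect (τ : G.Strategy Player.min) (x : V) :
    G.stratValue σ x ≤ expect (G.move σ τ x) (G.stratValue σ) :=
  (G.exists_isBestResponseMin_and_le_expect σ).choose_spec.2 τ x

theorem stratValue_le_value (τ : G.GenStrategy Player.min) (x : V) :
    G.stratValue σ x ≤ G.value σ.toGen τ x :=
  ciInf_le ⟨0, by rintro _ ⟨τ', rfl⟩; exact (G.value_mem _ τ' x).1⟩ τ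

theorem stratValue_le_of_supersolution (τ : G.Strategy Player.min) {w : V → ℝ}
    (hw : ∀ y, G.sinkVal y ≤ w y) (h : ∀ y, expect (G.move σ τ y) w ≤ w y) (x : V) :
    G.stratValue σ x ≤ w x :=
  (G.stratValue_le_value σ _ x).trans (G.value_le_of_supersolution σ τ hw h x)

variable {G σ} in
theorem IsBestResponseMin.expect_stratValue {τ : G.Strategy Player.min}
    (h : G.IsBestResponseMin σ τ) (x : V) :
    expect (G.move σ τ x) (G.stratValue σ) = G.stratValue σ x := by
  rw [funext fun x => G.stratValue_eq σ τ h x]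
  exact (G.value_eq_expect σ τ x).symm

theorem stratValue_sink {s : V} (hs : G.kind s = VertexKind.sink) :
    G.stratValue σ s = G.val s hs := by
  classical
  obtain ⟨τ, hτ⟩ := G.exists_isBestResponseMin σ
  refine le_antisymm ?_ ?_
  -- The largest candidate with the correct sink values; it is a supersolution since it is at most
  -- 1.
  · let w : V → ℝ := fun x => if G.kind x = VertexKind.sink then G.sinkVal x else 1
    have hw : ∀ x, w x ≤ 1 := fun x => by
      simp only [w]
      split_ifs
      · exact (G.sinkVal_mem x).2
      · exact le_rfl
    have h := G.stratValue_le_of_supersolution σ τ (w := w) (fun y => ?_) (fun y => ?_) s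
    · rwa [show w s = _ from if_pos hs, G.sinkVal_of_sink hs] at h
    · simp only [w]
      split_ifs
      · exact le_rfl
      · exact (G.sinkVal_mem y).2
    · by_cases hy : G.kind y = VertexKind.sink
      · rw [G.move_sink _ _ hy, expect_pure]
      · rw [show w y = _ from if_neg hy, ← expect_const (G.move σ τ y) 1]
        exact expect_mono _ hw
  · obtain ⟨v, hg, -, -, hv⟩ := G.exists_solution σ fun _ : Unit => τ
    rw [G.stratValue_eq σ τ hτ, ← G.sinkVal_of_sink hs]
    exact (hg s).trans (hv _ (fun k h => ⟨(), rfl⟩) s)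

theorem sinkVal_le_stratValue (x : V) : G.sinkVal x ≤ G.stratValue σ x := by
  by_cases hx : G.kind x = VertexKind.sink
  · rw [G.sinkVal_of_sink hx, G.stratValue_sink σ hx]
  · rw [G.sinkVal_of_not_sink hx]
    exact (G.stratValue_mem σ x).1

/-- If MIN can keep the play in a set without sinks, the values in this set vanish. -/
theorem stratValue_nonpos_of_closed (τ : G.Strategy Player.min) {S : Set V}
    (hS : ∀ x ∈ S, G.kind x ≠ VertexKind.sink)
    (hc : ∀ x ∈ S, ∀ y ∈ (G.move σ τ x).support, y ∈ S) {x : V} (hx : x ∈ S) :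
    G.stratValue σ x ≤ 0 := by
  classical
  -- A supersolution because the play never leaves `S`.
  let w : V → ℝ := fun x => if x ∈ S then 0 else 1
  have h := G.stratValue_le_of_supersolution σ τ (w := w) (fun y => ?_) (fun y => ?_) x
  · exact h.trans_eq (if_pos hx)
  · simp only [w]
    split_ifs with hy
    · exact (G.sinkVal_of_not_sink (hS y hy)).le
    · exact (G.sinkVal_mem y).2
  · by_cases hy : y ∈ S
    · rw [show w y = _ from if_pos hy, ← expect_const (G.move σ τ y) 0]
      exact (expect_congr _ fun z hz => if_pos (hc y hy z hz)).le
    · rw [show w y = _ from if_neg hy, ← expect_const (G.move σ τ y) 1]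
      refine expect_mono _ fun z => ?_
      simp only [w]
      split_ifs <;> norm_num

end Value

end SSG

/-! ### The transformed game and the comparison of values -/

namespace SSG

variable {V : Type*} {G : SSG V}

theorem reroute_eq (A : Set G.Arc) (x y : V) :
    reroute A x y = Sum.inl y ∨ ∃ e : A, reroute A x y = Sum.inr e ∧ e.1.1.2 = y := by
  unfold reroute
  split_ifs with h
  · exact Or.inr ⟨_, rfl, rfl⟩
  · exact Or.inl rfl

theorem reroute_of_sink (A : Set G.Arc) {x : V} (hx : G.kind x = VertexKind.sink) (y : V) :
    reroute A x y = Sum.inl y :=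
  dif_neg fun h => h.1 hx

/-- Different arcs get different new sinks, so agreement of lifted strategies implies agreement in
`G`. -/
theorem reroute_injective (A : Set G.Arc) (x : V) : Function.Injective (reroute A x) := by
  intro y z h
  rcases reroute_eq A x y with hy | ⟨e, hy, rfl⟩ <;>
    rcases reroute_eq A x z with hz | ⟨e', hz, rfl⟩ <;> rw [hy, hz] at h
  · exact Sum.inl_injective h
  · cases h
  · cases h
  · rw [Sum.inr_injective h]

variable [Finite V]

section Transform

variable (A : Set G.Arc) (σ ρ : G.Strategy Player.max)

/-- This pulls best responses in the transformed game back to strategies of `G`. -/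
theorem exists_lift_eq {p : Player} (τ' : (G.transformStrat A σ).Strategy p) :
    ∃ τ : G.Strategy p, G.lift A σ τ = τ' := by
  refine ⟨fun x hx => ⟨_, (τ' (Sum.inl x) hx).2.choose_spec.1⟩, ?_⟩
  funext z hz
  rcases z with x | e
  · exact Subtype.ext (τ' (Sum.inl x) hz).2.choose_spec.2.symm
  · nomatch hz

theorem move_lift (τ : G.Strategy Player.min) (x : V) :
    (G.transformStrat A σ).move (G.lift A σ ρ) (G.lift A σ τ) (Sum.inl x) =
      (G.move ρ τ x).map (reroute A x) := by
  rcases hx : G.kind x with (_ | _) | _ | _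
  · refine ((G.transformStrat A σ).move_max _ _ (x := Sum.inl x) hx).trans ?_
    rw [move_max _ _ _ hx, PMF.pure_map]
    rfl
  · refine ((G.transformStrat A σ).move_min _ _ (x := Sum.inl x) hx).trans ?_
    rw [move_min _ _ _ hx, PMF.pure_map]
    rfl
  · refine ((G.transformStrat A σ).move_random _ _ (x := Sum.inl x) hx).trans ?_
    rw [move_random _ _ _ hx]
    rfl
  · refine ((G.transformStrat A σ).move_sink _ _ (x := Sum.inl x) hx).trans ?_
    rw [move_sink _ _ _ hx, PMF.pure_map, reroute_of_sink A hx]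

theorem expect_move_lift (τ : G.Strategy Player.min) (x : V) (f : V ⊕ A → ℝ) :
    expect ((G.transformStrat A σ).move (G.lift A σ ρ) (G.lift A σ τ) (Sum.inl x)) f =
      expect (G.move ρ τ x) fun y => f (reroute A x y) := by
  rw [move_lift, expect_map]

theorem stratValue_lift_inr (e : A) :
    (G.transformStrat A σ).stratValue (G.lift A σ ρ) (Sum.inr e) = G.stratValue σ e.1.1.2 :=
  stratValue_sink _ _ rfl

theorem stratValue_lift_reroute (x y : V) :
    (G.transformStrat A σ).stratValue (G.lift A σ ρ) (reroute A x y) =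
        (G.transformStrat A σ).stratValue (G.lift A σ ρ) (Sum.inl y) ∧
        reroute A x y = Sum.inl y ∨
      (G.transformStrat A σ).stratValue (G.lift A σ ρ) (reroute A x y) = G.stratValue σ y := by
  rcases reroute_eq A x y with h | ⟨e, h, rfl⟩
  · exact Or.inl ⟨by rw [h], h⟩
  · exact Or.inr (by rw [h, stratValue_lift_inr])

/-- The transformation does not change the values of the strategy that it is based on. -/
theorem stratValue_lift_self (x : V) :
    (G.transformStrat A σ).stratValue (G.lift A σ σ) (Sum.inl x) = G.stratValue σ x := by
  have hle : ∀ x, (G.transformStrat A σ).stratValue (G.lift A σ σ) (Sum.inl x) ≤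
      G.stratValue σ x := by
    obtain ⟨τ, hτ⟩ := G.exists_isBestResponseMin σ
    let w : V ⊕ A → ℝ := Sum.elim (G.stratValue σ) fun e => G.stratValue σ e.1.1.2
    refine fun x => stratValue_le_of_supersolution _ _ (G.lift A σ τ) (w := w) ?_ ?_ (Sum.inl x)
    · rintro (y | e)
      · exact G.sinkVal_le_stratValue σ y
      · exact (sinkVal_of_sink _ rfl).le
    · rintro (y | e)
      · rw [expect_move_lift]
        refine le_of_eq_of_le (congrArg _ (funext fun z => ?_)) (hτ.expect_stratValue y).le
        rcases reroute_eq A y z with h | ⟨e, h, rfl⟩ <;> rw [h] <;> rfl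
      · rw [move_sink _ _ _ rfl, expect_pure]
  refine le_antisymm (hle x) ?_
  obtain ⟨τ', hτ'⟩ := exists_isBestResponseMin _ (G.lift A σ σ)
  obtain ⟨τ, rfl⟩ := exists_lift_eq A σ τ'
  -- The transformed values form a supersolution in `G`: by `hle`, undoing the rerouting of an arc
  -- never raises the value at its end.
  refine G.stratValue_le_of_supersolution σ τ (fun y => ?_) (fun y => ?_) x
    (w := fun x => (G.transformStrat A σ).stratValue (G.lift A σ σ) (Sum.inl x))
  · exact sinkVal_le_stratValue _ (G.lift A σ σ) (Sum.inl y)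
  · rw [← hτ'.expect_stratValue (Sum.inl y), expect_move_lift]
    refine expect_mono _ fun z => ?_
    rcases stratValue_lift_reroute A σ σ y z with h | h
    · exact h.1.ge
    · exact (hle z).trans h.ge

end Transform

/-- If `f` is a subsolution and `u` the value vector of a game, then the set where `f - u` attains
its maximum is closed under the moves of a best response, and `f` is a solution on it. -/
theorem eq_of_sub_eq_max {σ : G.Strategy Player.max} {τ : G.Strategy Player.min}
    (hτ : G.IsBestResponseMin σ τ) {f : V → ℝ} {d : ℝ} {x : V}
    (hmax : ∀ y, f y - G.stratValue σ y ≤ d) (hx : f x - G.stratValue σ x = d)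
    (hf : f x ≤ expect (G.move σ τ x) f) :
    f x = expect (G.move σ τ x) f ∧
      ∀ y ∈ (G.move σ τ x).support, f y - G.stratValue σ y = d := by
  have h1 := expect_sub (G.move σ τ x) f (G.stratValue σ)
  rw [hτ.expect_stratValue] at h1
  have h2 := expect_mono (G.move σ τ x) hmax
  rw [expect_const] at h2
  refine ⟨by linarith, fun y hy => eq_of_le_expect _ hmax (by linarith) hy⟩

/-- Strict switches do not decrease the values. -/
theorem stratValue_le_of_switch {σ σ' : G.Strategy Player.max}
    (h : ∀ x hx, G.stratValue σ x ≤ G.stratValue σ (σ' x hx).1)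
    (heq : ∀ x hx, G.stratValue σ x = G.stratValue σ (σ' x hx).1 → σ' x hx = σ x hx) (x : V) :
    G.stratValue σ x ≤ G.stratValue σ' x := by
  by_contra! hlt
  obtain ⟨τ, hτ⟩ := G.exists_isBestResponseMin σ'
  have : Nonempty V := ⟨x⟩
  obtain ⟨x₀, hx₀⟩ := Finite.exists_max fun y => G.stratValue σ y - G.stratValue σ' y
  have hpos : 0 < G.stratValue σ x₀ - G.stratValue σ' x₀ :=
    (sub_pos.2 hlt).trans_le (hx₀ x)
  have hsub : ∀ y, G.stratValue σ y ≤ expect (G.move σ' τ y) (G.stratValue σ) := fun y => by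
    by_cases hy : G.kind y = VertexKind.player Player.max
    · rw [move_max _ _ _ hy, expect_pure]
      exact h y hy
    · rw [move_congr (σ' := σ) (fun hy' => absurd hy' hy) fun _ => rfl]
      exact G.stratValue_le_expect σ τ y
  let S : Set V := {y | G.stratValue σ y - G.stratValue σ' y =
    G.stratValue σ x₀ - G.stratValue σ' x₀}
  have hS : ∀ y ∈ S, G.stratValue σ y = expect (G.move σ' τ y) (G.stratValue σ) ∧
      ∀ z ∈ (G.move σ' τ y).support, z ∈ S := fun y hy =>
    eq_of_sub_eq_max hτ hx₀ hy (hsub y)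
  have h0 := G.stratValue_nonpos_of_closed σ τ (S := S) (fun y hy hs => ?_) (fun y hy => ?_)
    (x := x₀) rfl
  · linarith [(G.stratValue_mem σ' x₀).1]
  · have : G.stratValue σ y - G.stratValue σ' y = _ := hy
    rw [G.stratValue_sink σ hs, G.stratValue_sink σ' hs] at this
    linarith
  -- On `S` the chosen successor has the same old value, so `heq` rules out a switch there and `S`
  -- is closed under `σ` too.
  · rw [move_congr (σ' := σ') (τ' := τ) (fun hx => (heq y hx ?_).symm) fun _ => rfl]
    · exact (hS y hy).2
    · have := (hS y hy).1
      rwa [move_max _ _ _ hx, expect_pure] at this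

/-- An improvement in a transformed game is an improvement in the game. -/
theorem Better.of_transformStrat {A : Set G.Arc} {σ σ' : G.Strategy Player.max}
    (h : (G.transformStrat A σ).StrictlyBetter (G.lift A σ σ') (G.lift A σ σ)) :
    G.Better σ' σ := by
  obtain ⟨⟨hge, hgt⟩, heq⟩ := h
  let U := (G.transformStrat A σ).stratValue (G.lift A σ σ')
  let w : V → ℝ := fun x => U (Sum.inl x)
  have hvw : ∀ x, G.stratValue σ x ≤ w x := fun x =>
    (stratValue_lift_self A σ x).ge.trans (hge (Sum.inl x))
  have hgt' : ∃ x, G.stratValue σ x < w x := by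
    obtain ⟨x | e, hx⟩ := hgt
    · exact ⟨x, (stratValue_lift_self A σ x).ge.trans_lt hx⟩
    · rw [stratValue_lift_inr, stratValue_lift_inr] at hx
      exact absurd hx (lt_irrefl _)
  have hagree : ∀ x hx, w x = G.stratValue σ x → σ' x hx = σ x hx := fun x hx hxw =>
    Subtype.ext (reroute_injective A x (congrArg Subtype.val
      (heq (Sum.inl x) hx (hxw.trans (stratValue_lift_self A σ x).symm))))
  -- A new sink has the old value of the end of its arc, which is at most `w` there.
  have hUw : ∀ x y, U (reroute A x y) ≤ w y := fun x y => by
    rcases stratValue_lift_reroute A σ σ' x y with hy | hy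
    · exact hy.1.le
    · exact hy.le.trans (hvw y)
  suffices hwu : ∀ x, w x ≤ G.stratValue σ' x from
    ⟨fun x => (hvw x).trans (hwu x), hgt'.imp fun x hx => hx.trans_le (hwu x)⟩
  by_contra! hlt
  obtain ⟨x, hlt⟩ := hlt
  obtain ⟨τ, hτ⟩ := G.exists_isBestResponseMin σ'
  have : Nonempty V := ⟨x⟩
  obtain ⟨x₀, hx₀⟩ := Finite.exists_max fun y => w y - G.stratValue σ' y
  have hpos : 0 < w x₀ - G.stratValue σ' x₀ := (sub_pos.2 hlt).trans_le (hx₀ x)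
  have hsubU : ∀ y, w y ≤ expect (G.move σ' τ y) fun z => U (reroute A y z) := fun y =>
    (stratValue_le_expect _ (G.lift A σ σ') (G.lift A σ τ) (Sum.inl y)).trans_eq
      (expect_move_lift A σ σ' τ y U)
  let S : Set V := {y | w y - G.stratValue σ' y = w x₀ - G.stratValue σ' x₀}
  have hS : ∀ y ∈ S, w y = expect (G.move σ' τ y) w ∧
      ∀ z ∈ (G.move σ' τ y).support, z ∈ S := fun y hy =>
    eq_of_sub_eq_max hτ hx₀ hy ((hsubU y).trans (expect_mono _ (hUw y)))
  have hSw : ∀ y ∈ S, 0 < w y := fun y hy => by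
    have h1 : w y - G.stratValue σ' y = _ := hy
    linarith [(G.stratValue_mem σ' y).1]
  have hSsink : ∀ y ∈ S, G.kind y ≠ VertexKind.sink := fun y hy hs => by
    have h1 : w y - G.stratValue σ' y = _ := hy
    have h2 : w y = G.val y hs := stratValue_sink _ _ (s := Sum.inl y) hs
    rw [h2, G.stratValue_sink σ' hs] at h1
    linarith
  -- The part of `S` with `w` equal to the old value is closed under `σ` and `τ`: there `w` is its
  -- own mean, and the old value, at most `w`, is a subsolution.
  have hSlt : ∀ y ∈ S, G.stratValue σ y < w y := fun y hy => by
    refine lt_of_le_of_ne (hvw y) fun hne => ?_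
    have h0 := G.stratValue_nonpos_of_closed σ τ (S := {z | z ∈ S ∧ w z = G.stratValue σ z})
      (fun z hz => hSsink z hz.1) (fun z hz z' hz' => ?_) (x := y) ⟨hy, hne.symm⟩
    · linarith [hSw y hy]
    · have hm : G.move σ' τ z = G.move σ τ z :=
        move_congr (fun hx => hagree z hx hz.2) fun _ => rfl
      have h1 := (hS z hz.1).1
      have h2 := G.stratValue_le_expect σ τ z
      rw [hm] at h1
      refine ⟨(hS z hz.1).2 z' (hm ▸ hz'), ?_⟩
      have h3 := eq_of_le_expect (G.move σ τ z) (f := fun y => G.stratValue σ y - w y) (d := 0)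
        (fun y => sub_nonpos.2 (hvw y)) (by rw [expect_sub]; linarith [hz.2]) hz'
      linarith
  have h0 := stratValue_nonpos_of_closed _ (G.lift A σ σ') (G.lift A σ τ) (S := Sum.inl '' S)
    (by rintro _ ⟨y, hy, rfl⟩; exact hSsink y hy) ?_ (x := Sum.inl x₀) ⟨x₀, rfl, rfl⟩
  · exact absurd h0 (not_le.2 (hSw x₀ rfl))
  -- Equality of means forces `U (reroute A y z) = w z`. On a rerouted arc this would be the old
  -- value of `z`, contrary to `hSlt`.
  · rintro _ ⟨y, hy, rfl⟩ z' hz'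
    rw [move_lift, PMF.support_map] at hz'
    obtain ⟨z, hz, rfl⟩ := hz'
    have hzS := (hS y hy).2 z hz
    have h1 := eq_of_le_expect (G.move σ' τ y) (f := fun z => U (reroute A y z) - w z) (d := 0)
      (fun z => sub_nonpos.2 (hUw y z))
      (by rw [expect_sub]; linarith [hsubU y, (hS y hy).1]) hz
    rcases stratValue_lift_reroute A σ σ' y z with h2 | h2
    · exact ⟨z, hzS, h2.2.symm⟩
    · have h3 := hSlt z hzS
      have h4 : U (reroute A y z) = G.stratValue σ z := h2
      linarith

end SSG

/-! ### Existence of improvements and termination -/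

namespace SSG

variable {V : Type*} [Finite V] {G : SSG V}

/-- If the best response `τ` and `σ` are not optimal, then `σ` has an improving switch. -/
theorem exists_switch {σ : G.Strategy Player.max} {τ : G.Strategy Player.min}
    (hτ : G.IsBestResponseMin σ τ) (h : ¬ G.IsOptimalPair σ τ) :
    ∃ x, G.kind x = VertexKind.player Player.max ∧
      ∃ y, G.Adj x y ∧ G.stratValue σ x < G.stratValue σ y := by
  by_contra! hno
  refine h ⟨hτ, fun σ' x => ?_⟩
  rw [← G.stratValue_eq σ τ hτ]
  -- Without improving switches the value vector of `σ` is a supersolution against `τ` for every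
  -- general MAX strategy.
  refine G.value_le_of_step_le _ _ x (G.sinkVal_le_stratValue σ) fun k h => ?_
  by_cases hx : G.kind h.last = VertexKind.player Player.max
  · rw [nextPMF_of_max _ _ _ _ hx, expect_pure]
    exact hno _ hx _ (σ' k h hx).2
  · refine le_of_eq_of_le (congrArg (expect · _) ?_) (hτ.expect_stratValue h.last).le
    rcases hk : G.kind h.last with (_ | _) | _ | _
    · exact absurd hk hx
    · exact (G.nextPMF_of_min _ _ _ hk).trans (G.move_min σ τ hk).symm
    · exact (G.nextPMF_of_random _ _ _ hk).trans (G.move_random σ τ hk).symm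
    · exact (G.nextPMF_of_sink _ _ _ hk).trans (G.move_sink σ τ hk).symm

/-- The search for a better strategy in the transformed game succeeds if the current pair is not
optimal. -/
theorem exists_strictlyBetter {σ : G.Strategy Player.max} {τ : G.Strategy Player.min}
    (hτ : G.IsBestResponseMin σ τ) (h : ¬ G.IsOptimalPair σ τ) (A : Set G.Arc) :
    ∃ σ', (G.transformStrat A σ).StrictlyBetter (G.lift A σ σ') (G.lift A σ σ) := by
  obtain ⟨x₀, hx₀, y₀, hadj, hlt⟩ := exists_switch hτ h
  -- One switch suffices, and the agreement clause then only concerns `x₀`, where the value strictly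
  -- increases.
  obtain ⟨σ', hσ₀, hσ'⟩ := exists_strategy_update σ x₀ fun _ => ⟨y₀, hadj⟩
  obtain ⟨τ', hτ'⟩ := exists_isBestResponseMin _ (G.lift A σ σ)
  obtain ⟨τ', rfl⟩ := exists_lift_eq A σ τ'
  have hre : ∀ x y, (G.transformStrat A σ).stratValue (G.lift A σ σ) (reroute A x y) =
      G.stratValue σ y := fun x y => by
    rcases stratValue_lift_reroute A σ σ x y with hy | hy
    · exact hy.1.trans (stratValue_lift_self A σ y)
    · exact hy
  have hgt : ∀ hx, (G.transformStrat A σ).stratValue (G.lift A σ σ) (Sum.inl x₀) <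
      (G.transformStrat A σ).stratValue (G.lift A σ σ) (G.lift A σ σ' (Sum.inl x₀) hx).1 :=
    fun hx => by
      have h1 : (G.lift A σ σ' (Sum.inl x₀) hx).1 = reroute A x₀ y₀ :=
        congrArg (fun z : {y // G.Adj x₀ y} => reroute A x₀ z.1) (congrFun hσ₀ hx)
      rw [h1, hre, stratValue_lift_self]
      exact hlt
  have hlift : ∀ x hx, x ≠ Sum.inl x₀ → G.lift A σ σ' x hx = G.lift A σ σ x hx := by
    rintro (x | e) hx hne
    · have hx' : x ≠ x₀ := fun h => hne (h ▸ rfl)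
      refine Subtype.ext (congrArg (reroute A x) ?_)
      rw [hσ' x hx']
    · nomatch hx
  have heq : ∀ x hx, (G.transformStrat A σ).stratValue (G.lift A σ σ) x =
      (G.transformStrat A σ).stratValue (G.lift A σ σ) (G.lift A σ σ x hx).1 := fun x hx => by
    conv_lhs => rw [← hτ'.expect_stratValue x, move_max _ _ _ hx, expect_pure]
  have hle : ∀ x, (G.transformStrat A σ).stratValue (G.lift A σ σ) x ≤
      (G.transformStrat A σ).stratValue (G.lift A σ σ') x := by
    refine stratValue_le_of_switch (fun x hx => ?_) fun x hx hx' => ?_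
    · by_cases hne : x = Sum.inl x₀
      · subst hne
        exact (hgt hx).le
      · rw [hlift x hx hne]
        exact (heq x hx).le
    · refine hlift x hx fun hne => ?_
      subst hne
      exact (hgt hx).ne hx'
  -- The new value at `x₀` is the new value of the new successor, at least its old value, which
  -- exceeds the old value at `x₀`.
  have hlt' : (G.transformStrat A σ).stratValue (G.lift A σ σ) (Sum.inl x₀) <
      (G.transformStrat A σ).stratValue (G.lift A σ σ') (Sum.inl x₀) := by
    obtain ⟨ρ, hρ⟩ := exists_isBestResponseMin _ (G.lift A σ σ')
    have hx : (G.transformStrat A σ).kind (Sum.inl x₀) = VertexKind.player Player.max := hx₀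
    rw [← hρ.expect_stratValue (Sum.inl x₀), move_max _ _ _ hx, expect_pure]
    exact (hgt hx).trans_le (hle _)
  exact ⟨σ', ⟨hle, _, hlt'⟩, fun x hx hx' => hlift x hx fun hne =>
    hlt'.ne' (hne ▸ hx')⟩

theorem Better.stratValue_lt {σ σ' : G.Strategy Player.max} (h : G.Better σ' σ) :
    G.stratValue σ < G.stratValue σ' :=
  Pi.lt_def.2 h

/-- There is no infinite sequence of steps of the algorithm. -/
theorem acc_GSIAStep (s : G.GSIAState) : Acc (fun s' s => G.GSIAStep s s') s := by
  have hwf : WellFounded fun σ' σ : G.Strategy Player.max => G.stratValue σ < G.stratValue σ' :=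
    have : IsTrans (G.Strategy Player.max) fun σ' σ => G.stratValue σ < G.stratValue σ' :=
      ⟨fun _ _ _ h h' => h'.trans h⟩
    have : Std.Irrefl fun σ' σ : G.Strategy Player.max => G.stratValue σ < G.stratValue σ' :=
      ⟨fun _ => lt_irrefl _⟩
    Finite.wellFounded_of_trans_of_irrefl _
  have himprove : ∀ σ A, (∀ σ', G.stratValue σ < G.stratValue σ' →
      Acc (fun s' s => G.GSIAStep s s') (.test σ')) →
      Acc (fun s' s => G.GSIAStep s s') (.improve σ A) := fun σ A ih => by
    refine ⟨_, fun s hs => ?_⟩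
    cases hs with
    | update _ σ' _ h => exact ih σ' (Better.of_transformStrat h).stratValue_lt
  have hhalt : ∀ σ τ, Acc (fun s' s => G.GSIAStep s s') (.halt σ τ) := fun σ τ =>
    ⟨_, fun s hs => nomatch hs⟩
  have htest : ∀ σ, Acc (fun s' s => G.GSIAStep s s') (.test σ) := fun σ => by
    induction σ using hwf.induction with
    | _ σ ih =>
      refine ⟨_, fun s hs => ?_⟩
      cases hs with
      | exit _ τ _ _ => exact hhalt σ τ
      | choose _ _ _ _ A => exact himprove σ A ih
  cases s with
  | start =>
    refine ⟨_, fun s hs => ?_⟩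
    cases hs
    exact htest _
  | test σ => exact htest σ
  | improve σ A => exact himprove σ A fun σ' _ => htest σ'
  | halt σ τ => exact hhalt σ τ

end SSG

end

/-- On every finite simple stochastic game, every execution of the generic strategy improvement
algorithm is finite, never gets stuck, and returns a pair of optimal positional strategies. -/
theorem mainTheorem1 {V : Type*} [Finite V] (G : SSG V) :
    (∀ run : ℕ → G.GSIAState, run 0 = SSG.GSIAState.start →
      ¬ ∀ n, G.GSIAStep (run n) (run (n + 1))) ∧
    (∀ s : G.GSIAState, Relation.ReflTransGen G.GSIAStep SSG.GSIAState.start s →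
      (∃ s', G.GSIAStep s s') ∨
        ∃ (σ : G.Strategy Player.max) (τ : G.Strategy Player.min),
          s = SSG.GSIAState.halt σ τ ∧ G.IsOptimalPair σ τ) := by
  refine ⟨fun run _ hrun => ?_, fun s hs => ?_⟩
  · have h : ∀ s : G.GSIAState, ∀ n, run n ≠ s := fun s => by
      induction SSG.acc_GSIAStep s with
      | intro s _ ih => exact fun n hn => ih _ (hn ▸ hrun n) (n + 1) rfl
    exact h _ 0 rfl
  -- The last step is inspected because an `improve` state does not itself record that its strategy
  -- is not optimal; the `choose` step leading to it does.
  · rcases hs.cases_tail with h | ⟨s', -, hs'⟩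
    · obtain ⟨σ⟩ := (inferInstance : Nonempty (G.Strategy Player.max))
      exact Or.inl ⟨.test σ, h ▸ SSG.GSIAStep.init σ⟩
    · have htest : ∀ σ, ∃ s', G.GSIAStep (.test σ) s' := fun σ => by
        obtain ⟨τ, hτ⟩ := G.exists_isBestResponseMin σ
        by_cases h : G.IsOptimalPair σ τ
        · exact ⟨_, .exit σ τ hτ h⟩
        · exact ⟨_, .choose σ τ hτ h ∅⟩
      cases hs' with
      | init σ => exact Or.inl (htest σ)
      | exit σ τ _ h => exact Or.inr ⟨σ, τ, rfl, h⟩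
      | choose σ τ hτ h A =>
        obtain ⟨σ', hσ'⟩ := SSG.exists_strictlyBetter hτ h A
        exact Or.inl ⟨_, .update σ σ' A hσ'⟩
      | update _ σ' _ _ => exact Or.inl (htest σ')
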